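/- Let $n\ge 1$ be an integer, let $\alpha>0$, let $f:[0,\alpha)\to\mathbb R$ be a $C^2$ function (with one-sided derivatives at $0$), and let $g:(0,\alpha)\to\mathbb R$ be defined by $f(t)=t\,g(t)$. For a $C^2$ function $h$ on $(0,\alpha)$ write $[x,y]_h=\frac{h(x)-h(y)}{x-y}$ if $x\neq y$ and $[x,x]_h=h'(x)$; and let $[x,y,z]_h$ be the second divided difference, which is invariant under permutations of $x,y,z$ and is given by $[x,y,z]_h=\frac{[x,y]_h-[y,z]_h}{x-z}$ if $x\ne z$ and by $[x,x,x]_h=\frac{h''(x)}{2}$. A real function $h$ on an interval $I$ is called $n$-monotone if $A\le B$ implies $h(A)\le h(B)$, and $n$-convex if $h(\lambda A+(1-\lambda)B)\le\lambda h(A)+(1-\lambda)h(B)$ for all $\lambda\in[0,1]$, in each case for all self-adjoint complex $n\times n$ matrices $A,B$ with all eigenvalues in $I$; here $\le$ is the Loewner order. Then: 1. $g$ is a $C^2$ function on $(0,\alpha)$. 2. For any distinct points $t_1,\dots,t_n\in(0,\alpha)$ and all $1\le i,j\le n$ (including $i=j$, $i=1$ and $j=1$), $$[t_1,t_i,t_j]_f=t_1\,[t_1,t_i,t_j]_g+[t_i,t_j]_g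 .$$ 3. If $g$ is both $n$-monotone and $n$-convex on $(0,\alpha)$, then $f$ is $n$-convex on $[0,\alpha)$. -/

import Mathlib

section MatrixFunctions

open scoped ComplexOrder MatrixOrder

/-- `f` is `n`-monotone (matrix monotone of order `n`) on `I`: if `A ≤ B` are self-adjoint complex
`n × n` matrices with all eigenvalues in `I`, then `f(A) ≤ f(B)`.  Here `≤` is the Loewner order
and `f(A)` is given by the functional calculus. (The spectrum is finite, so every `f` is
continuous on it and no continuity assumption is needed for `cfc`.) -/
def MatrixMonotoneOn (n : ℕ) (I : Set ℝ) (f : ℝ → ℝ) : Prop :=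
  ∀ A B : Matrix (Fin n) (Fin n) ℂ, IsSelfAdjoint A → IsSelfAdjoint B →
    spectrum ℝ A ⊆ I → spectrum ℝ B ⊆ I → A ≤ B → cfc f A ≤ cfc f B

/-- `f` is `n`-convex (matrix convex of order `n`) on `I`:
`f(cA + (1-c)B) ≤ c f(A) + (1-c) f(B)` for `c ∈ [0,1]` and all self-adjoint complex
`n × n` matrices `A`, `B` with all eigenvalues in `I`. -/
def MatrixConvexOn (n : ℕ) (I : Set ℝ) (f : ℝ → ℝ) : Prop :=
  ∀ A B : Matrix (Fin n) (Fin n) ℂ, IsSelfAdjoint A → IsSelfAdjoint B →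
    spectrum ℝ A ⊆ I → spectrum ℝ B ⊆ I → ∀ c : ℝ, c ∈ Set.Icc (0 : ℝ) 1 →
      cfc f (c • A + (1 - c) • B) ≤ c • cfc f A + (1 - c) • cfc f B

end MatrixFunctions

/-- The first divided difference `[x, y]_f`, with `[x, x]_f = f'(x)`. -/
noncomputable def divDiff₁ (f : ℝ → ℝ) (x y : ℝ) : ℝ :=
  if x = y then deriv f x else (f x - f y) / (x - y)

/-- The second divided difference `[x, y, z]_f`.  It is `([x, y]_f - [y, z]_f) / (x - z)` when
`x ≠ z`; the remaining cases are given by permutation invariance, `[x, y, x]_f = [x, x, y]_f`,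
when `x = z ≠ y`, and by `[x, x, x]_f = f''(x) / 2!`. -/
noncomputable def divDiff₂ (f : ℝ → ℝ) (x y z : ℝ) : ℝ :=
  if x ≠ z then (divDiff₁ f x y - divDiff₁ f y z) / (x - z)
  else if x ≠ y then (divDiff₁ f x x - divDiff₁ f x y) / (x - y)
  else iteratedDeriv 2 f x / (Nat.factorial 2 : ℝ)

open Polynomial Filter Topology

open scoped ComplexOrder MatrixOrder

/-! ### Divided differences -/

/-! Putting the Leibniz rule for `t * g t` with `x k` in the distinguished slot gives the matrix
identity `([x i, x k, x j]_f) = x k • ([x i, x k, x j]_g) + ([x i, x j]_g)`. The last matrix, the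
Löwner matrix of `g`, is positive semidefinite by monotonicity (`MatrixMonotoneOn.loewner_nonneg`);
the Kraus matrix of `g` is so by convexity (`MatrixConvexOn.kraus_nonneg`), and `x k > 0`. Thus all
Kraus matrices of `f` are positive semidefinite, which forces `f` to be `n`-convex on the open
interval (`matrixConvexOn_of_kraus_nonneg`); continuity at `0` adds the endpoint.

All three criteria rest on `reQuadForm_cfc_diagPerturb_expansion`, a second-order expansion of
`f(diag(x) + h H)` with divided differences as coefficients. For polynomials it follows by induction
on the degree, the Leibniz rule being the induction step. A `C^2` function is compared with a
polynomial having the same 2-jets at the nodes; eigenvalues move by `O(h)`, so the error is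
`o(h^2)`. Repeated nodes are allowed throughout. -/

lemma divDiff₁_comm (f : ℝ → ℝ) (x y : ℝ) : divDiff₁ f x y = divDiff₁ f y x := by
  unfold divDiff₁
  by_cases h : x = y
  · simp [h]
  · rw [if_neg h, if_neg (Ne.symm h), ← neg_sub (f y), ← neg_sub y, neg_div_neg_eq]

lemma divDiff₁_id_mul {f g : ℝ → ℝ} {x y : ℝ} (hx : f =ᶠ[𝓝 x] fun t ↦ t * g t)
    (hy : f =ᶠ[𝓝 y] fun t ↦ t * g t) (hg : DifferentiableAt ℝ g x) :
    divDiff₁ f x y = x * divDiff₁ g x y + g y := by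
  unfold divDiff₁
  split_ifs with h
  · subst h
    rw [hx.deriv_eq, deriv_fun_mul differentiableAt_fun_id hg]
    simp
    ring
  · have := sub_ne_zero.2 h
    rw [hx.eq_of_nhds, hy.eq_of_nhds]
    field_simp
    ring

/-- This is the fully confluent case of the Leibniz rule, before division by `2!`. -/
lemma iteratedDeriv_two_id_mul {f g : ℝ → ℝ} {x : ℝ} (hx : f =ᶠ[𝓝 x] fun t ↦ t * g t)
    (hg : ContDiffAt ℝ 2 g x) :
    iteratedDeriv 2 f x = x * iteratedDeriv 2 g x + 2 * deriv g x := by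
  have h1 : ∀ᶠ t in 𝓝 x, DifferentiableAt ℝ g t :=
    (hg.eventually (by simp)).mono fun t ht ↦ ht.differentiableAt (by norm_num)
  have h2 : deriv f =ᶠ[𝓝 x] fun t ↦ g t + t * deriv g t := by
    filter_upwards [hx.deriv, h1] with t ht ht1
    rw [ht, deriv_fun_mul differentiableAt_fun_id ht1]
    simp
  have h3 : DifferentiableAt ℝ (deriv g) x := by
    have h4 : DifferentiableAt ℝ (fderiv ℝ g) x :=
      (hg.fderiv_right (m := 1) (by norm_num)).differentiableAt (by norm_num)
    exact (h4.clm_apply (differentiableAt_const (1 : ℝ)))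
  rw [iteratedDeriv_succ, iteratedDeriv_one, h2.deriv_eq, iteratedDeriv_succ, iteratedDeriv_one,
    deriv_fun_add h1.self_of_nhds (differentiableAt_fun_id.fun_mul h3),
    deriv_fun_mul differentiableAt_fun_id h3]
  simp
  ring

/-- The Leibniz rule for the second divided difference of `t ↦ t * g t`. -/
lemma divDiff₂_id_mul {f g : ℝ → ℝ} {x y z : ℝ} (hx : f =ᶠ[𝓝 x] fun t ↦ t * g t)
    (hy : f =ᶠ[𝓝 y] fun t ↦ t * g t) (hz : f =ᶠ[𝓝 z] fun t ↦ t * g t)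
    (hgx : ContDiffAt ℝ 2 g x) (hgz : ContDiffAt ℝ 2 g z) :
    divDiff₂ f x y z = x * divDiff₂ g x y z + divDiff₁ g y z := by
  have dx := hgx.differentiableAt (by norm_num)
  have dz := hgz.differentiableAt (by norm_num)
  unfold divDiff₂
  split_ifs with h h'
  · have := sub_ne_zero.2 h
    rw [divDiff₁_id_mul hx hy dx, divDiff₁_comm f y z, divDiff₁_id_mul hz hy dz,
      divDiff₁_comm g z y]
    field_simp
    ring
  · push Not at h
    subst h
    have := sub_ne_zero.2 h'
    rw [divDiff₁_id_mul hx hx dx, divDiff₁_id_mul hx hy dx, divDiff₁_comm g y x,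
      show divDiff₁ g x y = (g x - g y) / (x - y) by rw [divDiff₁, if_neg h']]
    field_simp
    ring
  · push Not at h h'
    subst h h'
    rw [iteratedDeriv_two_id_mul hx hgx, divDiff₁, if_pos rfl]
    norm_num
    ring

lemma divDiff₁_congr {f g : ℝ → ℝ} {x y : ℝ} (hx : f x = g x) (hy : f y = g y)
    (hx' : deriv f x = deriv g x) : divDiff₁ f x y = divDiff₁ g x y := by
  simp only [divDiff₁, hx, hy, hx']

lemma divDiff₂_congr {f g : ℝ → ℝ} {x y z : ℝ} (hx : f x = g x) (hy : f y = g y) (hz : f z = g z)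
    (hx' : deriv f x = deriv g x) (hy' : deriv f y = deriv g y)
    (hx'' : iteratedDeriv 2 f x = iteratedDeriv 2 g x) :
    divDiff₂ f x y z = divDiff₂ g x y z := by
  simp only [divDiff₂, hx'', divDiff₁_congr hx hy hx', divDiff₁_congr hy hz hy',
    divDiff₁_congr hx hx hx']

lemma divDiff₁_add {f g : ℝ → ℝ} {x : ℝ} (y : ℝ) (hf : DifferentiableAt ℝ f x)
    (hg : DifferentiableAt ℝ g x) :
    divDiff₁ (fun t ↦ f t + g t) x y = divDiff₁ f x y + divDiff₁ g x y := by
  unfold divDiff₁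
  split_ifs with h
  · exact deriv_fun_add hf hg
  · ring

lemma divDiff₂_add {f g : ℝ → ℝ} {x y : ℝ} (z : ℝ) (hf : ContDiffAt ℝ 2 f x)
    (hg : ContDiffAt ℝ 2 g x) (hfy : DifferentiableAt ℝ f y) (hgy : DifferentiableAt ℝ g y) :
    divDiff₂ (fun t ↦ f t + g t) x y z = divDiff₂ f x y z + divDiff₂ g x y z := by
  have h1 := hf.differentiableAt (by norm_num)
  have h2 := hg.differentiableAt (by norm_num)
  unfold divDiff₂
  rw [divDiff₁_add _ h1 h2, divDiff₁_add _ hfy hgy, divDiff₁_add _ h1 h2,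
    iteratedDeriv_fun_add hf hg]
  split_ifs <;> ring

lemma divDiff₁_const (c x y : ℝ) : divDiff₁ (fun _ ↦ c) x y = 0 := by
  simp [divDiff₁]

lemma divDiff₂_const (c x y z : ℝ) : divDiff₂ (fun _ ↦ c) x y z = 0 := by
  simp [divDiff₂, divDiff₁_const, iteratedDeriv_const]

/-! ### Interpolation of 2-jets and the Taylor remainder -/

/-- Nodes are added one at a time: a correction divisible by the cube of `∏ (X - r)` over the old
nodes leaves their 2-jets unchanged. -/
lemma exists_polynomial_two_jet (s : Finset ℝ) (a b c : ℝ → ℝ) :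
    ∃ p : ℝ[X], ∀ t ∈ s, p.eval t = a t ∧ p.derivative.eval t = b t ∧
      p.derivative.derivative.eval t = c t := by
  induction s using Finset.induction_on with
  | empty => exact ⟨0, by simp⟩
  | insert t s ht ih =>
    obtain ⟨p, hp⟩ := ih
    set Q : ℝ[X] := ∏ r ∈ s, (X - C r) with hQ
    have hQt : Q.eval t ≠ 0 := by
      rw [hQ, eval_prod, Finset.prod_ne_zero_iff]
      intro r hr
      simp only [eval_sub, eval_X, eval_C]
      exact sub_ne_zero.2 (fun h ↦ ht (h ▸ hr))
    have hQs : ∀ r ∈ s, Q.eval r = 0 := by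
      intro r hr
      rw [hQ, eval_prod]
      exact Finset.prod_eq_zero hr (by simp)
    set N := Q ^ 3 with hN
    have hNt : N.eval t ≠ 0 := by simpa [hN] using hQt
    set N0 := N.eval t
    set N1 := N.derivative.eval t with hN1
    set N2 := N.derivative.derivative.eval t with hN2
    -- The numbers `u`, `v`, `w` solve the triangular system for the 2-jet of the correction at `t`,
    -- with diagonal entries `N0`, `N0`, `2 * N0`.
    set u := (a t - p.eval t) / N0 with hu
    set v := (b t - p.derivative.eval t - N1 * u) / N0 with hv
    set w := (c t - p.derivative.derivative.eval t - N2 * u - 2 * N1 * v) / (2 * N0) with hw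
    refine ⟨p + N * (C u + C v * (X - C t) + C w * ((X - C t) * (X - C t))), ?_⟩
    intro r hr
    rcases Finset.mem_insert.1 hr with rfl | hr
    · refine ⟨?_, ?_, ?_⟩
      · simp [hu]
        field_simp
        ring
      · simp [← hN1, hv]
        field_simp
        ring
      · simp [← hN1, ← hN2, hw]
        field_simp
        ring
    · have h0 := hQs r hr
      obtain ⟨h1, h2, h3⟩ := hp r hr
      refine ⟨?_, ?_, ?_⟩
      · simp [hN, h0, h1]
      · simp [hN, derivative_pow, h0, h2]
      · simp [hN, derivative_pow, h0, h3]

lemma isLittleO_sq_of_two_jet_eq_zero {q : ℝ → ℝ} {t : ℝ} (hq : ContDiffAt ℝ 2 q t)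
    (h0 : q t = 0) (h1 : deriv q t = 0) (h2 : iteratedDeriv 2 q t = 0) :
    q =o[𝓝 t] fun x ↦ (x - t) ^ 2 := by
  have h := hq.eventually (by simp)
  obtain ⟨r, hr, hball⟩ := Metric.eventually_nhds_iff_ball.1 h
  have ht := Metric.mem_ball_self (x := t) hr
  have hcd : ContDiffOn ℝ 2 q (Metric.ball t r) := fun x hx ↦ (hball x hx).contDiffWithinAt
  have key := taylor_isLittleO (n := 2) (convex_ball t r) ht hcd
  rw [Metric.isOpen_ball.nhdsWithin_eq ht] at key
  refine key.congr_left fun x ↦ ?_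
  rw [taylorWithinEval_succ, taylorWithinEval_succ, taylor_within_zero_eval,
    iteratedDerivWithin_of_isOpen Metric.isOpen_ball ht,
    iteratedDerivWithin_of_isOpen Metric.isOpen_ball ht]
  simp [h0, h1, h2]

/-! ### Quadratic forms of Hermitian matrices -/

section QuadraticForm

variable {ι : Type*} [Fintype ι]

/-- The real part of `w* M w`, as a real linear functional of the matrix `M`. -/
noncomputable def reQuadForm (w : ι → ℂ) : Matrix ι ι ℂ →ₗ[ℝ] ℝ where
  toFun M := (star w ⬝ᵥ M.mulVec w).re
  map_add' M N := by simp [Matrix.add_mulVec]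
  map_smul' c M := by simp [Matrix.smul_mulVec]

lemma reQuadForm_apply (w : ι → ℂ) (M : Matrix ι ι ℂ) :
    reQuadForm w M = (∑ i, ∑ j, star (w i) * M i j * w j).re := by
  simp only [reQuadForm, LinearMap.coe_mk, AddHom.coe_mk, dotProduct, Matrix.mulVec, Pi.star_apply,
    Finset.mul_sum, mul_assoc]

lemma reQuadForm_nonneg {M : Matrix ι ι ℂ} (hM : 0 ≤ M) (w : ι → ℂ) : 0 ≤ reQuadForm w M :=
  (Complex.nonneg_iff.1 ((Matrix.nonneg_iff_posSemidef.1 hM).dotProduct_mulVec_nonneg w)).1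

lemma reQuadForm_mono {M N : Matrix ι ι ℂ} (h : M ≤ N) (w : ι → ℂ) :
    reQuadForm w M ≤ reQuadForm w N := by
  have := reQuadForm_nonneg (sub_nonneg.2 h) w
  rw [map_sub] at this
  linarith

lemma nonneg_of_reQuadForm_nonneg {M : Matrix ι ι ℂ} (hM : M.IsHermitian)
    (h : ∀ w, 0 ≤ reQuadForm w M) : 0 ≤ M := by
  refine (Matrix.PosSemidef.of_dotProduct_mulVec_nonneg hM fun w ↦ ?_).nonneg
  exact Complex.nonneg_iff.2 ⟨h w, (hM.im_star_dotProduct_mulVec_self w).symm⟩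

lemma le_of_reQuadForm_le {M N : Matrix ι ι ℂ} (hM : M.IsHermitian) (hN : N.IsHermitian)
    (h : ∀ w, reQuadForm w M ≤ reQuadForm w N) : M ≤ N := by
  refine sub_nonneg.1 (nonneg_of_reQuadForm_nonneg (hN.sub hM) fun w ↦ ?_)
  rw [map_sub]
  linarith [h w]

lemma continuous_reQuadForm (w : ι → ℂ) : Continuous (reQuadForm w) :=
  LinearMap.continuous_of_finiteDimensional _

variable [DecidableEq ι]

lemma continuousOn_spectrum_real (f : ℝ → ℝ) (A : Matrix ι ι ℂ) : ContinuousOn f (spectrum ℝ A) :=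
  A.finite_real_spectrum.continuousOn f

/-- The spectral bound gives `-c ≤ f(A) ≤ c` in the Loewner order; `reQuadForm w 1` is the squared
norm of `w`. -/
lemma abs_reQuadForm_cfc_le {f : ℝ → ℝ} {A : Matrix ι ι ℂ} (hA : IsSelfAdjoint A) {c : ℝ}
    (h : ∀ x ∈ spectrum ℝ A, |f x| ≤ c) (w : ι → ℂ) :
    |reQuadForm w (cfc f A)| ≤ c * reQuadForm w 1 := by
  have hc := continuousOn_spectrum_real f A
  have h1 := reQuadForm_mono (cfc_le_algebraMap f c A (fun x hx ↦ (abs_le.1 (h x hx)).2) hc hA) w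
  have h2 := reQuadForm_mono
    (algebraMap_le_cfc f (-c) A (fun x hx ↦ (abs_le.1 (h x hx)).1) hc hA) w
  rw [Algebra.algebraMap_eq_smul_one, map_smul, smul_eq_mul] at h1 h2
  rw [abs_le]
  constructor <;> linarith

/-! ### Perturbations of a real diagonal matrix -/

/-- The Hermitian perturbation `diag(x) + h H` of a real diagonal matrix. -/
noncomputable def diagPerturb (x : ι → ℝ) (H : Matrix ι ι ℂ) (h : ℝ) : Matrix ι ι ℂ :=
  Matrix.diagonal (fun i ↦ (x i : ℂ)) + h • H

omit [Fintype ι] in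
lemma isHermitian_diagonal_ofReal (x : ι → ℝ) :
    (Matrix.diagonal (fun i ↦ (x i : ℂ))).IsHermitian :=
  Matrix.isHermitian_diagonal_of_self_adjoint _ (by ext i; simp)

omit [Fintype ι] [DecidableEq ι] in
lemma isSelfAdjoint_real_smul {H : Matrix ι ι ℂ} (hH : IsSelfAdjoint H) (h : ℝ) :
    IsSelfAdjoint (h • H) :=
  IsSelfAdjoint.smul (IsSelfAdjoint.all h) hH

lemma isSelfAdjoint_diagPerturb (x : ι → ℝ) {H : Matrix ι ι ℂ} (hH : IsSelfAdjoint H) (h : ℝ) :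
    IsSelfAdjoint (diagPerturb x H h) :=
  IsSelfAdjoint.add (isHermitian_diagonal_ofReal x) (isSelfAdjoint_real_smul hH h)

/-- Gershgorin's circle theorem, with the row sum enlarged to a sum over all entries so that the
bound does not depend on the row. -/
lemma exists_abs_sub_le_of_mem_spectrum_diagPerturb (x : ι → ℝ) (H : Matrix ι ι ℂ) (h : ℝ) {μ : ℝ}
    (hμ : μ ∈ spectrum ℝ (diagPerturb x H h)) :
    ∃ i, |μ - x i| ≤ |h| * ∑ i, ∑ j, ‖H i j‖ := by
  have h1 : (μ : ℂ) ∈ spectrum ℂ (diagPerturb x H h) := spectrum.algebraMap_mem ℂ hμ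
  rw [← Matrix.spectrum_toLin', ← Module.End.hasEigenvalue_iff_mem_spectrum] at h1
  obtain ⟨k, hk⟩ := eigenvalue_mem_ball h1
  refine ⟨k, ?_⟩
  rw [Metric.mem_closedBall, dist_eq_norm] at hk
  have h2 : ∑ j ∈ Finset.univ.erase k, ‖diagPerturb x H h k j‖ =
      ∑ j ∈ Finset.univ.erase k, |h| * ‖H k j‖ := by
    refine Finset.sum_congr rfl fun j hj ↦ ?_
    simp [diagPerturb, Matrix.diagonal_apply_ne' _ (Finset.ne_of_mem_erase hj)]
  have h3 : ((μ - x k : ℝ) : ℂ) = (μ - diagPerturb x H h k k) + h * H k k := by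
    simp [diagPerturb]
    ring
  calc |μ - x k| = ‖((μ - x k : ℝ) : ℂ)‖ := by simp only [Complex.norm_real, Real.norm_eq_abs]
    _ ≤ ‖(μ : ℂ) - diagPerturb x H h k k‖ + ‖(h : ℂ) * H k k‖ := by rw [h3]; exact norm_add_le _ _
    _ ≤ ∑ j ∈ Finset.univ.erase k, |h| * ‖H k j‖ + |h| * ‖H k k‖ := by
        rw [← h2, norm_mul, Complex.norm_real, Real.norm_eq_abs]
        gcongr
    _ = |h| * ∑ j, ‖H k j‖ := by
        rw [Finset.sum_erase_add _ _ (Finset.mem_univ k), Finset.mul_sum]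
    _ ≤ |h| * ∑ i, ∑ j, ‖H i j‖ := by
        refine mul_le_mul_of_nonneg_left ?_ (abs_nonneg h)
        exact Finset.single_le_sum (f := fun i ↦ ∑ j, ‖H i j‖)
          (fun i _ ↦ Finset.sum_nonneg fun _ _ ↦ norm_nonneg _) (Finset.mem_univ k)

/-- A property holding near every `x i` holds on the spectrum of `diag(x) + h H` for small `h`,
with a rate. -/
lemma eventually_forall_mem_spectrum_diagPerturb (x : ι → ℝ) (H : Matrix ι ι ℂ)
    {P : ι → ℝ → Prop} (hP : ∀ i, ∀ᶠ y in 𝓝 (x i), P i y) :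
    ∀ᶠ h : ℝ in 𝓝 0, ∀ μ ∈ spectrum ℝ (diagPerturb x H h),
      ∃ i, P i μ ∧ |μ - x i| ≤ |h| * ∑ i, ∑ j, ‖H i j‖ := by
  have hP' : ∀ i, ∃ r > 0, ∀ y, |y - x i| < r → P i y := fun i ↦ by
    simpa [Real.dist_eq] using Metric.eventually_nhds_iff.1 (hP i)
  choose r hr hrP using hP'
  have h1 : Tendsto (fun h : ℝ ↦ |h| * ∑ i, ∑ j, ‖H i j‖) (𝓝 0) (𝓝 0) :=
    Continuous.tendsto' (by fun_prop) _ _ (by simp)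
  filter_upwards [eventually_all.2 fun i ↦ h1.eventually (gt_mem_nhds (hr i))] with h hh μ hμ
  obtain ⟨i, hi⟩ := exists_abs_sub_le_of_mem_spectrum_diagPerturb x H h hμ
  exact ⟨i, hrP i μ (hi.trans_lt (hh i)), hi⟩

lemma eventually_spectrum_diagPerturb_subset (x : ι → ℝ) (H : Matrix ι ι ℂ) {U : Set ℝ}
    (hU : IsOpen U) (hx : ∀ i, x i ∈ U) :
    ∀ᶠ h : ℝ in 𝓝 0, spectrum ℝ (diagPerturb x H h) ⊆ U := by
  filter_upwards [eventually_forall_mem_spectrum_diagPerturb x H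
    (P := fun _ y ↦ y ∈ U) fun i ↦ hU.mem_nhds (hx i)] with h hh μ hμ
  exact (hh μ hμ).choose_spec.1

lemma isLittleO_reQuadForm_cfc_diagPerturb (x : ι → ℝ) {H : Matrix ι ι ℂ} (hH : IsSelfAdjoint H)
    {q : ℝ → ℝ} (hq : ∀ i, q =o[𝓝 (x i)] fun y ↦ (y - x i) ^ 2) (w : ι → ℂ) :
    (fun h : ℝ ↦ reQuadForm w (cfc q (diagPerturb x H h))) =o[𝓝 0] fun h ↦ h ^ 2 := by
  rw [Asymptotics.isLittleO_iff]
  intro c hc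
  set C := ∑ i, ∑ j, ‖H i j‖
  set W := reQuadForm w (1 : Matrix ι ι ℂ)
  have hW : 0 ≤ W := reQuadForm_nonneg (Matrix.PosSemidef.one.nonneg) w
  have hCW : 0 ≤ C ^ 2 * W := by positivity
  -- The `+ 1` keeps the denominator positive when `H` or `w` vanishes.
  set ε := c / (C ^ 2 * W + 1)
  have hε : 0 < ε := by positivity
  filter_upwards [eventually_forall_mem_spectrum_diagPerturb x H fun i ↦
    Asymptotics.isLittleO_iff.1 (hq i) hε] with h hh
  have h1 : ∀ μ ∈ spectrum ℝ (diagPerturb x H h), |q μ| ≤ ε * (|h| * C) ^ 2 := by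
    intro μ hμ
    obtain ⟨i, hi1, hi2⟩ := hh μ hμ
    simp only [norm_pow, Real.norm_eq_abs] at hi1
    refine hi1.trans ?_
    gcongr
  rw [Real.norm_eq_abs, norm_pow, Real.norm_eq_abs]
  refine (abs_reQuadForm_cfc_le (isSelfAdjoint_diagPerturb x hH h) h1 w).trans ?_
  have h2 : ε * (C ^ 2 * W) ≤ c := by
    rw [div_mul_eq_mul_div, div_le_iff₀ (by positivity)]
    nlinarith
  calc ε * (|h| * C) ^ 2 * W = ε * (C ^ 2 * W) * |h| ^ 2 := by ring
    _ ≤ c * |h| ^ 2 := by gcongr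

/-! ### Second-order expansion of the functional calculus -/

/-- The value `f(diag(x))`. -/
noncomputable def divDiffMatrix₀ (f : ℝ → ℝ) (x : ι → ℝ) : Matrix ι ι ℂ :=
  Matrix.diagonal fun i ↦ (f (x i) : ℂ)

/-- The first-order term of `h ↦ f(diag(x) + h H)`. -/
noncomputable def divDiffMatrix₁ (f : ℝ → ℝ) (x : ι → ℝ) (H : Matrix ι ι ℂ) : Matrix ι ι ℂ :=
  Matrix.of fun i j ↦ (divDiff₁ f (x i) (x j) : ℂ) * H i j

/-- The second-order term of `h ↦ f(diag(x) + h H)`. -/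
noncomputable def divDiffMatrix₂ (f : ℝ → ℝ) (x : ι → ℝ) (H : Matrix ι ι ℂ) : Matrix ι ι ℂ :=
  Matrix.of fun i j ↦ ∑ k, (divDiff₂ f (x i) (x k) (x j) : ℂ) * (H i k * H k j)

lemma contDiffAt_eval (p : ℝ[X]) (t : ℝ) : ContDiffAt ℝ 2 p.eval t := by
  have := (p.contDiff_aeval (𝕜 := ℝ) 2).contDiffAt (x := t)
  simpa using this

/-- Passing from `p` to `X * p` multiplies the expansion on the left by `D + h H`; the coefficients
of `1`, `h`, `h ^ 2` then match the Leibniz rules for divided differences. -/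
lemma aeval_diagPerturb_expansion (x : ι → ℝ) (H : Matrix ι ι ℂ) (p : ℝ[X]) :
    ∃ R : ℝ → Matrix ι ι ℂ, Continuous R ∧ ∀ h, aeval (diagPerturb x H h) p =
      divDiffMatrix₀ p.eval x + h • divDiffMatrix₁ p.eval x H
        + h ^ 2 • divDiffMatrix₂ p.eval x H + h ^ 3 • R h := by
  induction p using Polynomial.induction_on with
  | C a =>
    refine ⟨fun _ ↦ 0, continuous_const, fun h ↦ ?_⟩
    ext i j
    simp [divDiffMatrix₀, divDiffMatrix₁, divDiffMatrix₂, divDiff₁_const, divDiff₂_const,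
      Matrix.algebraMap_matrix_apply, Matrix.diagonal_apply]
  | add p q hp hq =>
    obtain ⟨R, hR, hp⟩ := hp
    obtain ⟨S, hS, hq⟩ := hq
    refine ⟨fun h ↦ R h + S h, hR.add hS, fun h ↦ ?_⟩
    have e : (p + q).eval = fun t ↦ p.eval t + q.eval t := by ext t; simp
    have hcp : ∀ t, ContDiffAt ℝ 2 p.eval t := fun t ↦ contDiffAt_eval p t
    have hcq : ∀ t, ContDiffAt ℝ 2 q.eval t := fun t ↦ contDiffAt_eval q t
    have h1 : divDiffMatrix₁ (p + q).eval x H =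
        divDiffMatrix₁ p.eval x H + divDiffMatrix₁ q.eval x H := by
      ext i j
      simp only [divDiffMatrix₁, e, Matrix.of_apply, Matrix.add_apply,
        divDiff₁_add _ p.differentiableAt q.differentiableAt]
      push_cast
      ring
    have h2 : divDiffMatrix₂ (p + q).eval x H =
        divDiffMatrix₂ p.eval x H + divDiffMatrix₂ q.eval x H := by
      ext i j
      simp only [divDiffMatrix₂, e, Matrix.of_apply, Matrix.add_apply,
        divDiff₂_add _ (hcp _) (hcq _) p.differentiableAt q.differentiableAt,
        ← Finset.sum_add_distrib]
      push_cast
      simp only [add_mul]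
    have h0 : divDiffMatrix₀ (p + q).eval x = divDiffMatrix₀ p.eval x + divDiffMatrix₀ q.eval x := by
      simp [divDiffMatrix₀, Matrix.diagonal_add]
    rw [map_add, hp, hq, h0, h1, h2]
    module
  | monomial n a hp =>
    obtain ⟨R, hR, hp⟩ := hp
    set p : ℝ[X] := C a * X ^ n with hpdef
    have hX : C a * X ^ (n + 1) = X * p := by rw [hpdef]; ring
    have e : ∀ t, (X * p).eval =ᶠ[𝓝 t] fun t ↦ t * p.eval t :=
      fun t ↦ Eventually.of_forall fun t ↦ by simp
    have hcp : ∀ t, ContDiffAt ℝ 2 p.eval t := fun t ↦ contDiffAt_eval p t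
    set D : Matrix ι ι ℂ := Matrix.diagonal (fun i ↦ (x i : ℂ)) with hD
    -- These are the terms of the product carrying at least `h ^ 3`.
    refine ⟨fun h ↦ D * R h + H * divDiffMatrix₂ p.eval x H + h • (H * R h), by fun_prop,
      fun h ↦ ?_⟩
    have h0 : divDiffMatrix₀ (X * p).eval x = D * divDiffMatrix₀ p.eval x := by
      simp [hD, divDiffMatrix₀, Matrix.diagonal_mul_diagonal]
    have h1 : divDiffMatrix₁ (X * p).eval x H = D * divDiffMatrix₁ p.eval x H +
        H * divDiffMatrix₀ p.eval x := by
      ext i j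
      simp only [divDiffMatrix₀, divDiffMatrix₁, divDiff₁_id_mul (e _) (e _) p.differentiableAt, hD,
        Matrix.add_apply, Matrix.diagonal_mul, Matrix.mul_diagonal, Matrix.of_apply]
      push_cast
      ring
    have h2 : divDiffMatrix₂ (X * p).eval x H = D * divDiffMatrix₂ p.eval x H +
        H * divDiffMatrix₁ p.eval x H := by
      ext i j
      rw [Matrix.add_apply, hD, Matrix.diagonal_mul, Matrix.mul_apply]
      simp only [divDiffMatrix₂, divDiffMatrix₁,
        divDiff₂_id_mul (e _) (e _) (e _) (hcp _) (hcp _), Matrix.of_apply, Finset.mul_sum,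
        ← Finset.sum_add_distrib]
      refine Finset.sum_congr rfl fun k _ ↦ ?_
      push_cast
      ring
    rw [hX, map_mul, aeval_X, hp, h0, h1, h2]
    have : diagPerturb x H h = D + h • H := rfl
    rw [this]
    simp only [add_mul, mul_add, smul_mul_assoc, mul_smul_comm, smul_add, smul_smul]
    module

/-- The second-order Peano expansion of the functional calculus at a real diagonal matrix. -/
theorem reQuadForm_cfc_diagPerturb_expansion (x : ι → ℝ) {H : Matrix ι ι ℂ}
    (hH : IsSelfAdjoint H) {f : ℝ → ℝ} (hf : ∀ i, ContDiffAt ℝ 2 f (x i)) (w : ι → ℂ) :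
    (fun h : ℝ ↦ reQuadForm w (cfc f (diagPerturb x H h)) -
      (reQuadForm w (divDiffMatrix₀ f x) +
        h * reQuadForm w (divDiffMatrix₁ f x H) + h ^ 2 * reQuadForm w (divDiffMatrix₂ f x H)))
      =o[𝓝 0] fun h ↦ h ^ 2 := by
  -- Divided differences up to second order at the nodes depend only on 2-jets there, so `f` and `p`
  -- share all three coefficient matrices.
  obtain ⟨p, hp⟩ := exists_polynomial_two_jet (Finset.univ.image x) f (deriv f) (iteratedDeriv 2 f)
  replace hp := fun i ↦ hp (x i) (Finset.mem_image_of_mem x (Finset.mem_univ i))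
  have hp0 : ∀ i, f (x i) = p.eval (x i) := fun i ↦ (hp i).1.symm
  have hp1 : ∀ i, deriv f (x i) = deriv p.eval (x i) := fun i ↦ by rw [p.deriv, (hp i).2.1]
  have hp2 : ∀ i, iteratedDeriv 2 f (x i) = iteratedDeriv 2 p.eval (x i) := fun i ↦ by
    rw [← (hp i).2.2, iteratedDeriv_succ, iteratedDeriv_one]
    have : deriv p.eval = p.derivative.eval := by ext t; exact p.deriv
    rw [this, Polynomial.deriv]
  have hq : ∀ i, (fun t ↦ f t - p.eval t) =o[𝓝 (x i)] fun y ↦ (y - x i) ^ 2 := fun i ↦ by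
    have hpc : ContDiffAt ℝ 2 p.eval (x i) := contDiffAt_eval p _
    refine isLittleO_sq_of_two_jet_eq_zero ((hf i).sub hpc) ?_ ?_ ?_
    · simp [hp0]
    · rw [deriv_fun_sub ((hf i).differentiableAt (by norm_num)) p.differentiableAt, hp1, sub_self]
    · rw [iteratedDeriv_fun_sub (hf i) hpc, hp2, sub_self]
  have h0 : divDiffMatrix₀ f x = divDiffMatrix₀ p.eval x := by simp only [divDiffMatrix₀, hp0]
  have h1 : divDiffMatrix₁ f x H = divDiffMatrix₁ p.eval x H := by
    ext i j
    simp only [divDiffMatrix₁, Matrix.of_apply,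
      divDiff₁_congr (hp0 i) (hp0 j) (hp1 i)]
  have h2 : divDiffMatrix₂ f x H = divDiffMatrix₂ p.eval x H := by
    ext i j
    simp only [divDiffMatrix₂, Matrix.of_apply,
      divDiff₂_congr (hp0 i) (hp0 _) (hp0 j) (hp1 i) (hp1 _) (hp2 i)]
  obtain ⟨R, hR, hpR⟩ := aeval_diagPerturb_expansion x H p
  have hrem : (fun h : ℝ ↦ h ^ 3 * reQuadForm w (R h)) =o[𝓝 0] fun h ↦ h ^ 2 := by
    have hb : (fun h ↦ reQuadForm w (R h)) =O[𝓝 (0 : ℝ)] fun _ ↦ (1 : ℝ) :=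
      ((continuous_reQuadForm w).comp hR).continuousAt.isBigO_one ℝ
    have hl : (fun h : ℝ ↦ h ^ 3) =o[𝓝 0] fun h : ℝ ↦ h ^ 2 :=
      Asymptotics.isLittleO_pow_pow (by norm_num)
    simpa using hl.mul_isBigO hb
  refine ((isLittleO_reQuadForm_cfc_diagPerturb x hH hq w).add hrem).congr_left fun h ↦ ?_
  have hA := isSelfAdjoint_diagPerturb x hH h
  rw [cfc_sub f p.eval _ (continuousOn_spectrum_real _ _) (continuousOn_spectrum_real _ _),
    cfc_polynomial p _ hA, hpR h, h0, h1, h2]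
  simp only [map_sub, map_add, map_smul, smul_eq_mul]
  ring

end QuadraticForm

/-- The Leibniz rule singles out the first argument, whereas Kraus matrices carry the fixed node in
the middle. -/
lemma divDiff₂_swap (f : ℝ → ℝ) (x y z : ℝ) : divDiff₂ f x y z = divDiff₂ f y x z := by
  by_cases hxy : x = y
  · rw [hxy]
  have h1 := sub_ne_zero.2 hxy
  have h1' := sub_ne_zero.2 (Ne.symm hxy)
  by_cases hxz : x = z
  · subst hxz
    simp only [divDiff₂, ne_eq, not_true_eq_false, if_false, hxy, not_false_eq_true, if_true,
      Ne.symm hxy, divDiff₁_comm f y x]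
    field_simp
    ring
  have h2 := sub_ne_zero.2 hxz
  by_cases hyz : y = z
  · subst hyz
    simp only [divDiff₂, ne_eq, not_true_eq_false, if_false, hxy, not_false_eq_true, if_true,
      Ne.symm hxy, divDiff₁_comm f y x]
    field_simp
    ring
  have h3 := sub_ne_zero.2 hyz
  simp only [divDiff₂, divDiff₁, ne_eq, hxz, hyz, hxy, Ne.symm hxy, not_false_eq_true, if_true,
    if_false]
  field_simp
  ring

/-! ### Peano expansions of real functions -/

section Peano

/-- `φ` has the second-order Peano expansion `φ (s + h) = a + h b + h² c + o(h²)` at `s`. -/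
def HasPeanoExpansion (φ : ℝ → ℝ) (s a b c : ℝ) : Prop :=
  (fun h : ℝ ↦ φ (s + h) - (a + h * b + h ^ 2 * c)) =o[𝓝 0] fun h ↦ h ^ 2

variable {φ : ℝ → ℝ} {s a b c : ℝ}

lemma HasPeanoExpansion.congr_of_shift {φ' : ℝ → ℝ} {s' : ℝ} (H : HasPeanoExpansion φ s a b c)
    (h : ∀ h, φ' (s' + h) = φ (s + h)) : HasPeanoExpansion φ' s' a b c := by
  simpa only [HasPeanoExpansion, h] using H

lemma HasPeanoExpansion.apply_eq (H : HasPeanoExpansion φ s a b c) : φ s = a := by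
  have h := (Asymptotics.isLittleO_iff.1 H one_pos).self_of_nhds
  simp at h
  linarith

lemma HasPeanoExpansion.continuousAt (H : HasPeanoExpansion φ s a b c) : ContinuousAt φ s := by
  have h1 : Tendsto (fun h : ℝ ↦ φ (s + h) - (a + h * b + h ^ 2 * c)) (𝓝 0) (𝓝 0) :=
    Asymptotics.IsLittleO.trans_tendsto H (Continuous.tendsto' (by fun_prop) _ _ (by simp))
  have h2 : Tendsto (fun h : ℝ ↦ a + h * b + h ^ 2 * c) (𝓝 0) (𝓝 a) :=
    Continuous.tendsto' (by fun_prop) _ _ (by simp)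
  have h3 : Tendsto (fun h : ℝ ↦ φ (s + h)) (𝓝 0) (𝓝 (φ s)) := by
    rw [H.apply_eq]
    simpa using h1.add h2
  have h4 : Tendsto (fun t : ℝ ↦ t - s) (𝓝 s) (𝓝 0) :=
    Continuous.tendsto' (by fun_prop) _ _ (by simp)
  simpa [ContinuousAt, Function.comp_def] using h3.comp h4

lemma HasPeanoExpansion.tendsto_slope (H : HasPeanoExpansion φ s a b c) :
    Tendsto (fun h ↦ (φ (s + h) - φ s) / h) (𝓝[≠] 0) (𝓝 b) := by
  have h1 := (H.tendsto_div_nhds_zero).mono_left (nhdsWithin_le_nhds (s := {0}ᶜ))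
  have hid : Tendsto (fun h : ℝ ↦ h) (𝓝[≠] 0) (𝓝 0) := tendsto_id.mono_left nhdsWithin_le_nhds
  have h2 := ((h1.mul hid).add_const b).add (hid.mul_const c)
  simp only [mul_zero, zero_add, zero_mul, add_zero] at h2
  refine h2.congr' ?_
  filter_upwards [self_mem_nhdsWithin] with h hh
  rw [Set.mem_compl_singleton_iff] at hh
  rw [H.apply_eq]
  field_simp
  ring

/-- The linear terms cancel between `h` and `-h`, and the quadratic ones add up. -/
lemma HasPeanoExpansion.tendsto_second_difference (H : HasPeanoExpansion φ s a b c) :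
    Tendsto (fun h ↦ (φ (s + h) + φ (s - h) - 2 * φ s) / h ^ 2) (𝓝[≠] 0) (𝓝 (2 * c)) := by
  have h0 := H.tendsto_div_nhds_zero
  have hneg : Tendsto (fun h : ℝ ↦ -h) (𝓝 0) (𝓝 0) :=
    Continuous.tendsto' (by fun_prop) _ _ (by simp)
  have h1 := ((h0.add (h0.comp hneg)).add_const (2 * c)).mono_left
    (nhdsWithin_le_nhds (s := {0}ᶜ))
  simp only [zero_add] at h1
  refine h1.congr' ?_
  filter_upwards [self_mem_nhdsWithin] with h hh
  rw [Set.mem_compl_singleton_iff] at hh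
  simp only [Function.comp, ← sub_eq_add_neg]
  rw [H.apply_eq]
  field_simp
  ring

lemma HasPeanoExpansion.add_quadratic (H : HasPeanoExpansion φ s a b c) (p q ε : ℝ) :
    HasPeanoExpansion (fun t ↦ φ t + (p + q * t + ε * t ^ 2)) s (a + (p + q * s + ε * s ^ 2))
      (b + (q + 2 * ε * s)) (c + ε) :=
  Asymptotics.IsLittleO.congr_left H fun h ↦ by ring

/-- A function with Peano expansions whose quadratic coefficients are nonnegative lies below its
chords. -/
lemma le_chord_of_hasPeanoExpansion
    (H : ∀ s ∈ Set.Icc (0 : ℝ) 1, ∃ a b c, 0 ≤ c ∧ HasPeanoExpansion φ s a b c)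
    {t : ℝ} (ht : t ∈ Set.Icc (0 : ℝ) 1) : φ t ≤ t * φ 1 + (1 - t) * φ 0 := by
  refine le_of_forall_pos_le_add fun ε hε ↦ ?_
  -- Here `ψ s` is `φ s` minus its chord minus `ε * s * (1 - s)`. It vanishes at both ends and has
  -- strictly positive quadratic coefficients, so a positive maximum would be interior and
  -- contradict the sign of the second difference.
  set ψ : ℝ → ℝ := fun s ↦ φ s + (-φ 0 + (φ 0 - φ 1 - ε) * s + ε * s ^ 2) with hψ
  have hH : ∀ s ∈ Set.Icc (0 : ℝ) 1, ∃ a b c, 0 < c ∧ HasPeanoExpansion ψ s a b c := by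
    intro s hs
    obtain ⟨a, b, c, hc, h⟩ := H s hs
    exact ⟨_, _, _, by positivity, h.add_quadratic (-φ 0) (φ 0 - φ 1 - ε) ε⟩
  have hcont : ContinuousOn ψ (Set.Icc 0 1) := fun s hs ↦ by
    obtain ⟨a, b, c, -, h⟩ := hH s hs
    exact h.continuousAt.continuousWithinAt
  obtain ⟨s, hs, hmax⟩ := isCompact_Icc.exists_isMaxOn ⟨t, ht⟩ hcont
  have hψt : ψ t ≤ 0 := by
    by_contra! hpos
    have hψs : 0 < ψ s := hpos.trans_le (hmax ht)
    have hs' : s ∈ Set.Ioo (0 : ℝ) 1 := by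
      refine ⟨lt_of_le_of_ne hs.1 ?_, lt_of_le_of_ne hs.2 ?_⟩
      · rintro rfl
        simp [hψ] at hψs
      · rintro rfl
        simp only [hψ] at hψs
        linarith
    obtain ⟨a, b, c, hc, h⟩ := hH s hs
    have hlim := h.tendsto_second_difference
    have hplus : ∀ᶠ h : ℝ in 𝓝[≠] 0, s + h ∈ Set.Ioo (0 : ℝ) 1 :=
      nhdsWithin_le_nhds ((Continuous.tendsto' (by fun_prop) _ _ (by simp) :
        Tendsto (fun h : ℝ ↦ s + h) (𝓝 0) (𝓝 s)) (isOpen_Ioo.mem_nhds hs'))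
    have hminus : ∀ᶠ h : ℝ in 𝓝[≠] 0, s - h ∈ Set.Ioo (0 : ℝ) 1 :=
      nhdsWithin_le_nhds ((Continuous.tendsto' (by fun_prop) _ _ (by simp) :
        Tendsto (fun h : ℝ ↦ s - h) (𝓝 0) (𝓝 s)) (isOpen_Ioo.mem_nhds hs'))
    have hle : 2 * c ≤ 0 := by
      refine le_of_tendsto hlim ?_
      filter_upwards [hplus, hminus] with h h1 h2
      have e1 : ψ (s + h) ≤ ψ s := hmax (Set.Ioo_subset_Icc_self h1)
      have e2 : ψ (s - h) ≤ ψ s := hmax (Set.Ioo_subset_Icc_self h2)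
      exact div_nonpos_of_nonpos_of_nonneg (by linarith) (sq_nonneg h)
    linarith
  simp only [hψ] at hψt
  nlinarith [ht.1, ht.2, mul_nonneg hε.le (sq_nonneg t), mul_le_mul_of_nonneg_left ht.2 hε.le]

end Peano

/-! ### Spectra of convex combinations -/

section Segment

variable {ι : Type*} [Fintype ι] [DecidableEq ι]

lemma isSelfAdjoint_convex_comb {A B : Matrix ι ι ℂ} (hA : IsSelfAdjoint A) (hB : IsSelfAdjoint B)
    (c : ℝ) : IsSelfAdjoint (c • A + (1 - c) • B) :=
  (isSelfAdjoint_real_smul hA c).add (isSelfAdjoint_real_smul hB (1 - c))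

/-- The spectral condition amounts to `a ≤ A ≤ b` in the Loewner order, which is linear in `A` and
so passes to convex combinations. -/
lemma spectrum_subset_Icc_iff {A : Matrix ι ι ℂ} (hA : IsSelfAdjoint A) {a b : ℝ} :
    spectrum ℝ A ⊆ Set.Icc a b ↔
      ∀ w, a * reQuadForm w 1 ≤ reQuadForm w A ∧ reQuadForm w A ≤ b * reQuadForm w 1 := by
  have h1 := algebraMap_le_cfc_iff id a A (continuousOn_spectrum_real _ _) hA
  have h2 := cfc_le_algebraMap_iff id b A (continuousOn_spectrum_real _ _) hA
  rw [cfc_id ℝ A hA] at h1 h2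
  have e : ∀ (w : ι → ℂ) (r : ℝ),
      reQuadForm w (algebraMap ℝ (Matrix ι ι ℂ) r) = r * reQuadForm w 1 := fun w r ↦ by
    rw [Algebra.algebraMap_eq_smul_one, map_smul, smul_eq_mul]
  have hs : ∀ r : ℝ, (algebraMap ℝ (Matrix ι ι ℂ) r).IsHermitian := fun r ↦
    IsSelfAdjoint.algebraMap _ (IsSelfAdjoint.all r)
  constructor
  · intro h w
    rw [← e, ← e]
    exact ⟨reQuadForm_mono (h1.2 fun x hx ↦ (h hx).1) w,
      reQuadForm_mono (h2.2 fun x hx ↦ (h hx).2) w⟩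
  · intro h x hx
    exact ⟨h1.1 (le_of_reQuadForm_le (hs a) hA fun w ↦ (e w a).le.trans (h w).1) x hx,
      h2.1 (le_of_reQuadForm_le hA (hs b) fun w ↦ (h w).2.trans (e w b).ge) x hx⟩

lemma Set.Finite.exists_subset_Icc_subset {F S : Set ℝ} (hF : F.Finite) (hS : S.OrdConnected)
    (hFS : F ⊆ S) : ∃ a b, F ⊆ Set.Icc a b ∧ Set.Icc a b ⊆ S := by
  rcases F.eq_empty_or_nonempty with rfl | hne
  · exact ⟨1, 0, by simp, by simp⟩
  · exact ⟨sInf F, sSup F, fun x hx ↦ ⟨csInf_le hF.bddBelow hx, le_csSup hF.bddAbove hx⟩,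
      hS.out (hFS (hne.csInf_mem hF)) (hFS (hne.csSup_mem hF))⟩

/-- Matrices with spectrum in an interval form a convex set. -/
lemma spectrum_convex_comb_subset {S : Set ℝ} (hS : S.OrdConnected) {A B : Matrix ι ι ℂ}
    (hA : IsSelfAdjoint A) (hB : IsSelfAdjoint B) (hAS : spectrum ℝ A ⊆ S)
    (hBS : spectrum ℝ B ⊆ S) {c : ℝ} (hc : c ∈ Set.Icc (0 : ℝ) 1) :
    spectrum ℝ (c • A + (1 - c) • B) ⊆ S := by
  obtain ⟨a, b, hab, habS⟩ := (A.finite_real_spectrum.union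
    B.finite_real_spectrum).exists_subset_Icc_subset hS (Set.union_subset hAS hBS)
  have hA' := (spectrum_subset_Icc_iff hA).1 (Set.subset_union_left.trans hab)
  have hB' := (spectrum_subset_Icc_iff hB).1 (Set.subset_union_right.trans hab)
  refine ((spectrum_subset_Icc_iff (isSelfAdjoint_convex_comb hA hB c)).2 fun w ↦ ?_).trans habS
  have h0 := hc.1
  have h1 : 0 ≤ 1 - c := sub_nonneg.2 hc.2
  rw [map_add, map_smul, map_smul, smul_eq_mul, smul_eq_mul]
  constructor
  · linarith [mul_le_mul_of_nonneg_left (hA' w).1 h0, mul_le_mul_of_nonneg_left (hB' w).1 h1]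
  · linarith [mul_le_mul_of_nonneg_left (hA' w).2 h0, mul_le_mul_of_nonneg_left (hB' w).2 h1]

end Segment

/-! ### Divided-difference criteria -/

section Criteria

variable {ι : Type*} [Fintype ι]

lemma reQuadForm_real_smul (ε : ℝ) (w : ι → ℂ) (M : Matrix ι ι ℂ) :
    reQuadForm (ε • w) M = ε ^ 2 * reQuadForm w M := by
  have : star (ε • w) ⬝ᵥ M.mulVec (ε • w) = ((ε ^ 2 : ℝ) : ℂ) * (star w ⬝ᵥ M.mulVec w) := by
    rw [Matrix.mulVec_smul, star_smul, smul_dotProduct, dotProduct_smul]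
    simp only [star_trivial, Complex.real_smul]
    push_cast
    ring
  simp only [reQuadForm, LinearMap.coe_mk, AddHom.coe_mk, this, Complex.re_ofReal_mul]

/-- Since `H i m` is the conjugate of `H m i`, grouping the triple sum by its middle index yields
one Kraus form for each `m`. -/
lemma reQuadForm_divDiffMatrix₂ (f : ℝ → ℝ) (x : ι → ℝ) {H : Matrix ι ι ℂ} (hH : IsSelfAdjoint H)
    (w : ι → ℂ) :
    reQuadForm w (divDiffMatrix₂ f x H) = ∑ m, reQuadForm (fun j ↦ H m j * w j)
      (Matrix.of fun i j ↦ (divDiff₂ f (x i) (x m) (x j) : ℂ)) := by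
  have hstar : ∀ i j, star (H i j) = H j i := fun i j ↦ Matrix.IsHermitian.apply hH j i
  simp only [reQuadForm_apply, divDiffMatrix₂, Matrix.of_apply, ← Complex.re_sum]
  congr 1
  simp only [Finset.mul_sum, Finset.sum_mul]
  rw [Finset.sum_comm (s := Finset.univ (α := ι)) (f := fun m i ↦ ∑ j, star (H m i * w i) *
    (divDiff₂ f (x i) (x m) (x j) : ℂ) * (H m j * w j))]
  refine Finset.sum_congr rfl fun i _ ↦ ?_
  rw [Finset.sum_comm]
  refine Finset.sum_congr rfl fun k _ ↦ Finset.sum_congr rfl fun j _ ↦ ?_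
  rw [star_mul', hstar]
  ring

variable [DecidableEq ι]

lemma hasPeanoExpansion_reQuadForm_cfc (x : ι → ℝ) {H : Matrix ι ι ℂ}
    (hH : IsSelfAdjoint H) {f : ℝ → ℝ} (hf : ∀ i, ContDiffAt ℝ 2 f (x i)) (w : ι → ℂ) :
    HasPeanoExpansion (fun h ↦ reQuadForm w (cfc f (diagPerturb x H h))) 0
      (reQuadForm w (divDiffMatrix₀ f x)) (reQuadForm w (divDiffMatrix₁ f x H))
      (reQuadForm w (divDiffMatrix₂ f x H)) := by
  simpa [HasPeanoExpansion] using reQuadForm_cfc_diagPerturb_expansion x hH hf w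

variable {n : ℕ} {U : Set ℝ} {f : ℝ → ℝ}

/-- The Löwner matrix of a matrix monotone function is positive semidefinite. -/
theorem MatrixMonotoneOn.loewner_nonneg (hU : IsOpen U) (hf : ∀ t ∈ U, ContDiffAt ℝ 2 f t)
    (hmono : MatrixMonotoneOn n U f) {x : Fin n → ℝ} (hx : ∀ i, x i ∈ U) (w : Fin n → ℂ) :
    0 ≤ reQuadForm w (Matrix.of fun i j ↦ (divDiff₁ f (x i) (x j) : ℂ)) := by
  -- The all-ones matrix is positive semidefinite and is the unit for entrywise products, so the
  -- first-order term is the Löwner matrix itself.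
  set H : Matrix (Fin n) (Fin n) ℂ := Matrix.vecMulVec 1 (star 1) with hHdef
  have hHpos : H.PosSemidef := Matrix.posSemidef_vecMulVec_self_star 1
  have hH : IsSelfAdjoint H := hHpos.1
  have e : divDiffMatrix₁ f x H = Matrix.of fun i j ↦ (divDiff₁ f (x i) (x j) : ℂ) := by
    ext i j
    simp [divDiffMatrix₁, hHdef]
  have hlim := (hasPeanoExpansion_reQuadForm_cfc x hH (fun i ↦ hf _ (hx i)) w).tendsto_slope
  rw [e] at hlim
  have hlim' := hlim.mono_left (nhdsWithin_mono 0 (fun h (hh : 0 < h) ↦ hh.ne') :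
    𝓝[>] (0 : ℝ) ≤ 𝓝[≠] 0)
  refine ge_of_tendsto hlim' ?_
  have hspec := eventually_spectrum_diagPerturb_subset x H hU hx
  filter_upwards [self_mem_nhdsWithin, nhdsWithin_le_nhds hspec] with h hh hs
  have h0 : (0 : ℝ) < h := hh
  refine div_nonneg (sub_nonneg.2 (reQuadForm_mono ?_ w)) h0.le
  refine hmono _ _ (isSelfAdjoint_diagPerturb x hH _) (isSelfAdjoint_diagPerturb x hH _)
    hspec.self_of_nhds (by simpa using hs) ?_
  have : diagPerturb x H (0 + h) - diagPerturb x H 0 = h • H := by simp [diagPerturb]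
  rw [← sub_nonneg, this, Matrix.nonneg_iff_posSemidef]
  exact hHpos.smul h0.le

/-- Midpoint convexity at `diag(x) ± h H` makes the second differences nonnegative, and they tend to
twice the second-order term. -/
lemma MatrixConvexOn.divDiffMatrix₂_nonneg (hU : IsOpen U) (hf : ∀ t ∈ U, ContDiffAt ℝ 2 f t)
    (hconv : MatrixConvexOn n U f) {x : Fin n → ℝ} (hx : ∀ i, x i ∈ U)
    {H : Matrix (Fin n) (Fin n) ℂ} (hH : IsSelfAdjoint H) (w : Fin n → ℂ) :
    0 ≤ reQuadForm w (divDiffMatrix₂ f x H) := by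
  have hlim := (hasPeanoExpansion_reQuadForm_cfc x hH
    (fun i ↦ hf _ (hx i)) w).tendsto_second_difference
  suffices 0 ≤ 2 * reQuadForm w (divDiffMatrix₂ f x H) by linarith
  refine ge_of_tendsto hlim ?_
  have hspec := eventually_spectrum_diagPerturb_subset x H hU hx
  have hneg : Tendsto (fun h : ℝ ↦ 0 - h) (𝓝 0) (𝓝 0) :=
    Continuous.tendsto' (by fun_prop) _ _ (by simp)
  filter_upwards [nhdsWithin_le_nhds hspec, nhdsWithin_le_nhds (hneg.eventually hspec)]
    with h hs hs'
  have key := hconv _ _ (isSelfAdjoint_diagPerturb x hH h) (isSelfAdjoint_diagPerturb x hH (0 - h))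
    hs hs' (1 / 2) (by norm_num)
  have e : (1 / 2 : ℝ) • diagPerturb x H h + (1 - 1 / 2 : ℝ) • diagPerturb x H (0 - h) =
      diagPerturb x H 0 := by
    simp only [diagPerturb]
    module
  rw [e] at key
  have key' := reQuadForm_mono key w
  simp only [map_add, map_smul, smul_eq_mul] at key'
  rw [zero_add]
  exact div_nonneg (by linarith) (sq_nonneg h)

/-- The matrices of second divided differences of a matrix convex function are positive
semidefinite. -/
theorem MatrixConvexOn.kraus_nonneg (hU : IsOpen U) (hf : ∀ t ∈ U, ContDiffAt ℝ 2 f t)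
    (hconv : MatrixConvexOn n U f) {x : Fin n → ℝ} (hx : ∀ i, x i ∈ U) (k : Fin n)
    (y : Fin n → ℂ) :
    0 ≤ reQuadForm y (Matrix.of fun i j ↦ (divDiff₂ f (x i) (x k) (x j) : ℂ)) := by
  set K : Fin n → Matrix (Fin n) (Fin n) ℂ :=
    fun m ↦ Matrix.of fun i j ↦ (divDiff₂ f (x i) (x m) (x j) : ℂ) with hK
  set b := ∑ m ∈ Finset.univ.erase k, reQuadForm (Pi.single k (y k)) (K m)
  have key : ∀ ε : ℝ, 0 < ε → 0 ≤ reQuadForm y (K k) + ε ^ 2 * b := by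
    intro ε hε
    have hε' : (ε : ℂ) ≠ 0 := by exact_mod_cast hε.ne'
    -- With the test vector `y i / ε` off `k` and `y k` at `k`, row `k` of `H` reproduces `y`, while
    -- every other row leaves only `ε * y k` in position `k`. The unwanted Kraus forms thus carry a
    -- factor `ε ^ 2`.
    set H : Matrix (Fin n) (Fin n) ℂ := Matrix.of fun i j ↦
      if i = k then (if j = k then 1 else (ε : ℂ)) else if j = k then (ε : ℂ) else 0 with hHdef
    have hH : IsSelfAdjoint H := by
      refine Matrix.IsHermitian.ext fun i j ↦ ?_
      simp only [hHdef, Matrix.of_apply]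
      split_ifs <;> simp
    have h := hconv.divDiffMatrix₂_nonneg hU hf hx hH fun i ↦ if i = k then y k else y i / ε
    rw [reQuadForm_divDiffMatrix₂ f x hH, ← Finset.add_sum_erase _ _ (Finset.mem_univ k)] at h
    convert h using 2
    · refine congrArg (fun v ↦ reQuadForm v (K k)) (funext fun j ↦ ?_)
      by_cases hj : j = k
      · simp [hHdef, hj]
      · simp only [hHdef, Matrix.of_apply, if_true, hj, if_false]
        field_simp
    · rw [Finset.mul_sum]
      refine Finset.sum_congr rfl fun m hm ↦ ?_
      have hmk := Finset.ne_of_mem_erase hm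
      rw [← reQuadForm_real_smul]
      refine congrArg (fun v ↦ reQuadForm v (K m)) (funext fun j ↦ ?_)
      by_cases hj : j = k
      · subst hj
        simp [hHdef, hmk]
      · simp [hHdef, hmk, hj]
  have hlim : Tendsto (fun ε : ℝ ↦ reQuadForm y (K k) + ε ^ 2 * b) (𝓝[>] 0)
      (𝓝 (reQuadForm y (K k))) :=
    (Continuous.tendsto' (by fun_prop) _ _ (by simp)).mono_left nhdsWithin_le_nhds
  exact ge_of_tendsto hlim (by filter_upwards [self_mem_nhdsWithin] with ε hε using key ε hε)

/-- If all matrices of second divided differences of `f` are positive semidefinite, then `f` is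
matrix convex. -/
theorem matrixConvexOn_of_kraus_nonneg (hU' : U.OrdConnected)
    (hf : ∀ t ∈ U, ContDiffAt ℝ 2 f t)
    (hK : ∀ x : Fin n → ℝ, (∀ i, x i ∈ U) → ∀ k y,
      0 ≤ reQuadForm y (Matrix.of fun i j ↦ (divDiff₂ f (x i) (x k) (x j) : ℂ))) :
    MatrixConvexOn n U f := by
  intro A B hA hB hAU hBU c hc
  refine le_of_reQuadForm_le (cfc_predicate f _)
    (isSelfAdjoint_convex_comb (cfc_predicate f A) (cfc_predicate f B) c) fun w ↦ ?_
  have main := le_chord_of_hasPeanoExpansion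
    (φ := fun s : ℝ ↦ reQuadForm w (cfc f (s • A + (1 - s) • B))) (t := c) ?_ hc
  · simpa using main
  intro s hs
  set X := s • A + (1 - s) • B with hXdef
  have hX : X.IsHermitian := isSelfAdjoint_convex_comb hA hB s
  have hXU : spectrum ℝ X ⊆ U := spectrum_convex_comb_subset hU' hA hB hAU hBU hs
  have hxU : ∀ i, hX.eigenvalues i ∈ U := fun i ↦ hXU (hX.eigenvalues_mem_spectrum_real i)
  set V := hX.eigenvectorUnitary
  -- Conjugation by an eigenbasis of `X` turns the segment through `X` into a perturbation of a real
  -- diagonal matrix.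
  set Φ := Unitary.conjStarAlgAut ℝ (Matrix (Fin n) (Fin n) ℂ) V with hΦdef
  set H := Φ.symm (A - B)
  have hH : IsSelfAdjoint H := (hA.sub hB).map Φ.symm
  have hseg : ∀ h : ℝ, (s + h) • A + (1 - (s + h)) • B = Φ (diagPerturb hX.eigenvalues H h) := by
    intro h
    have h1 : Φ (Matrix.diagonal fun i ↦ (hX.eigenvalues i : ℂ)) = X := hX.spectral_theorem.symm
    have h2 : Φ H = A - B := Φ.apply_symm_apply _
    rw [diagPerturb, map_add, map_smul, h1, h2, hXdef]
    module
  have hQ : ∀ M, reQuadForm w (Φ M) = reQuadForm ((star (V : Matrix _ _ ℂ)).mulVec w) M := by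
    intro M
    simp only [reQuadForm, LinearMap.coe_mk, AddHom.coe_mk, hΦdef, Unitary.conjStarAlgAut_apply]
    congr 1
    rw [Matrix.star_mulVec, ← Matrix.mulVec_mulVec, ← Matrix.mulVec_mulVec, Matrix.dotProduct_mulVec,
      Matrix.star_eq_conjTranspose, Matrix.conjTranspose_conjTranspose]
  have hcfc : ∀ h : ℝ, cfc f (Φ (diagPerturb hX.eigenvalues H h)) =
      Φ (cfc f (diagPerturb hX.eigenvalues H h)) := fun h ↦
    (StarAlgHomClass.map_cfc Φ f _ (continuousOn_spectrum_real _ _)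
      (LinearMap.continuous_of_finiteDimensional Φ.toAlgEquiv.toLinearMap)
      (isSelfAdjoint_diagPerturb _ hH h) ((isSelfAdjoint_diagPerturb _ hH h).map Φ)).symm
  have hexp := hasPeanoExpansion_reQuadForm_cfc hX.eigenvalues hH (fun i ↦ hf _ (hxU i))
    ((star (V : Matrix _ _ ℂ)).mulVec w)
  refine ⟨_, _, _, ?_, hexp.congr_of_shift fun h ↦ ?_⟩
  · rw [reQuadForm_divDiffMatrix₂ f _ hH]
    exact Finset.sum_nonneg fun m _ ↦ hK _ hxU m _
  · simp only [zero_add]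
    rw [hseg, hcfc, hQ]

/-- Matrix convexity extends to the left endpoint of the interval by continuity. -/
theorem MatrixConvexOn.Ico_of_Ioo {a b : ℝ} (hconv : MatrixConvexOn n (Set.Ioo a b) f)
    (hf : ContinuousOn f (Set.Ico a b)) : MatrixConvexOn n (Set.Ico a b) f := by
  have hcomp : ∀ (A : Matrix (Fin n) (Fin n) ℂ), IsSelfAdjoint A → ∀ (g : ℝ → ℝ) (ε : ℝ),
      cfc g (A + algebraMap ℝ _ ε) = cfc (fun t ↦ g (t + ε)) A := by
    intro A hA g ε
    rw [cfc_comp' g (fun t ↦ t + ε) A ((A.finite_real_spectrum.image _).continuousOn _)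
      (continuousOn_spectrum_real _ _) hA, cfc_add_const ε (fun t ↦ t) A
      (continuousOn_spectrum_real _ _) hA, cfc_id' ℝ A hA]
  have hspec : ∀ (A : Matrix (Fin n) (Fin n) ℂ), spectrum ℝ A ⊆ Set.Ico a b →
      ∀ᶠ ε : ℝ in 𝓝[>] 0, ∀ x ∈ spectrum ℝ A, x + ε ∈ Set.Ioo a b := by
    intro A hA
    -- Finiteness of the spectrum gives one range of shifts that keeps all eigenvalues below `b`.
    rw [eventually_all_finite A.finite_real_spectrum]
    intro x hx
    filter_upwards [Ioo_mem_nhdsGT (sub_pos.2 (hA hx).2)] with ε hε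
    exact ⟨by linarith [(hA hx).1, hε.1], by linarith [hε.2]⟩
  have hlim : ∀ (A : Matrix (Fin n) (Fin n) ℂ), IsSelfAdjoint A → spectrum ℝ A ⊆ Set.Ico a b →
      ∀ w, Tendsto (fun ε : ℝ ↦ reQuadForm w (cfc f (A + algebraMap ℝ _ ε))) (𝓝[>] 0)
        (𝓝 (reQuadForm w (cfc f A))) := by
    intro A hA hAs w
    rw [tendsto_iff_norm_sub_tendsto_zero]
    have hlim1 : ∀ x ∈ spectrum ℝ A,
        Tendsto (fun ε : ℝ ↦ |f (x + ε) - f x|) (𝓝[>] 0) (𝓝 0) := by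
      intro x hx
      have h1 : Tendsto (fun ε : ℝ ↦ x + ε) (𝓝[>] 0) (𝓝[Set.Ico a b] x) := by
        refine tendsto_nhdsWithin_iff.2 ⟨(Continuous.tendsto' (by fun_prop) _ _
          (by simp)).mono_left nhdsWithin_le_nhds, ?_⟩
        filter_upwards [hspec A hAs] with ε hε using Set.Ioo_subset_Ico_self (hε x hx)
      have h2 := ((hf x (hAs hx)).tendsto.comp h1).sub_const (f x)
      simpa using h2.abs
    have hsum : Tendsto (fun ε : ℝ ↦ (∑ x ∈ A.finite_real_spectrum.toFinset,
        |f (x + ε) - f x|) * reQuadForm w 1) (𝓝[>] 0) (𝓝 0) := by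
      have := (tendsto_finsetSum A.finite_real_spectrum.toFinset
        fun x hx ↦ hlim1 x (by simpa using hx)).mul_const (reQuadForm w 1)
      simpa using this
    refine squeeze_zero (fun _ ↦ norm_nonneg _) (fun ε ↦ ?_) hsum
    -- Both terms become functions of the same matrix `A`, so their difference is controlled by
    -- values on a fixed finite spectrum.
    rw [hcomp A hA, ← map_sub, ← cfc_sub _ _ _ (continuousOn_spectrum_real _ _)
      (continuousOn_spectrum_real _ _), Real.norm_eq_abs]
    refine abs_reQuadForm_cfc_le hA (fun x hx ↦ ?_) w
    exact Finset.single_le_sum (f := fun x ↦ |f (x + ε) - f x|) (fun _ _ ↦ abs_nonneg _)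
      (by simpa using hx)
  have hshift : ∀ (A : Matrix (Fin n) (Fin n) ℂ) (ε : ℝ),
      (∀ x ∈ spectrum ℝ A, x + ε ∈ Set.Ioo a b) →
      spectrum ℝ (A + algebraMap ℝ _ ε) ⊆ Set.Ioo a b := by
    intro A ε h x hx
    have h1 : x - ε ∈ spectrum ℝ A := by
      rwa [← spectrum.add_mem_add_iff (s := ε), sub_add_cancel, add_comm]
    simpa using h _ h1
  have hsa : ∀ (A : Matrix (Fin n) (Fin n) ℂ), IsSelfAdjoint A → ∀ ε : ℝ,
      IsSelfAdjoint (A + algebraMap ℝ _ ε) := fun A hA ε ↦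
    hA.add (IsSelfAdjoint.algebraMap _ (IsSelfAdjoint.all ε))
  intro A B hA hB hAs hBs c hc
  have hC := isSelfAdjoint_convex_comb hA hB c
  have hCs := spectrum_convex_comb_subset Set.ordConnected_Ico hA hB hAs hBs hc
  refine le_of_reQuadForm_le (cfc_predicate f _)
    (isSelfAdjoint_convex_comb (cfc_predicate f A) (cfc_predicate f B) c) fun w ↦ ?_
  rw [map_add, map_smul, map_smul, smul_eq_mul, smul_eq_mul]
  refine le_of_tendsto_of_tendsto (hlim _ hC hCs w)
    (((hlim A hA hAs w).const_mul c).add ((hlim B hB hBs w).const_mul (1 - c))) ?_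
  filter_upwards [hspec A hAs, hspec B hBs] with ε h1 h2
  have key := reQuadForm_mono (hconv _ _ (hsa A hA ε) (hsa B hB ε) (hshift A ε h1)
    (hshift B ε h2) c hc) w
  have e : c • (A + algebraMap ℝ _ ε) + (1 - c) • (B + algebraMap ℝ _ ε) =
      c • A + (1 - c) • B + algebraMap ℝ (Matrix (Fin n) (Fin n) ℂ) ε := by
    module
  rw [e] at key
  simpa only [map_add, map_smul, smul_eq_mul] using key

end Criteria

/-! ### The main theorem -/

theorem mainTheorem7 (n : ℕ) (hn : 0 < n) (α : ℝ) (hα : 0 < α) (f g : ℝ → ℝ)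
    (hf : ContDiffOn ℝ 2 f (Set.Ico 0 α))
    (hfg : ∀ t ∈ Set.Ioo 0 α, f t = t * g t) :
    ContDiffOn ℝ 2 g (Set.Ioo 0 α) ∧
    (∀ t : Fin n → ℝ, Function.Injective t → (∀ i, t i ∈ Set.Ioo 0 α) →
      ∀ i j : Fin n,
        divDiff₂ f (t ⟨0, hn⟩) (t i) (t j) =
          t ⟨0, hn⟩ * divDiff₂ g (t ⟨0, hn⟩) (t i) (t j) + divDiff₁ g (t i) (t j)) ∧
    (MatrixMonotoneOn n (Set.Ioo 0 α) g → MatrixConvexOn n (Set.Ioo 0 α) g →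
      MatrixConvexOn n (Set.Ico 0 α) f) := by
  have hg : ContDiffOn ℝ 2 g (Set.Ioo 0 α) := by
    -- On the open interval `g` is the quotient `f t / t` with nonvanishing denominator.
    refine ((hf.mono Set.Ioo_subset_Ico_self).div contDiffOn_id fun t ht ↦ ht.1.ne').congr
      fun t ht ↦ ?_
    rw [Pi.div_apply, hfg t ht]
    exact (mul_div_cancel_left₀ _ ht.1.ne').symm
  have hfc : ∀ t ∈ Set.Ioo 0 α, ContDiffAt ℝ 2 f t := fun t ht ↦
    (hf.mono Set.Ioo_subset_Ico_self).contDiffAt (isOpen_Ioo.mem_nhds ht)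
  have hgc : ∀ t ∈ Set.Ioo 0 α, ContDiffAt ℝ 2 g t := fun t ht ↦
    hg.contDiffAt (isOpen_Ioo.mem_nhds ht)
  have hev : ∀ t ∈ Set.Ioo 0 α, f =ᶠ[𝓝 t] fun t ↦ t * g t := fun t ht ↦ by
    filter_upwards [isOpen_Ioo.mem_nhds ht] with s hs using hfg s hs
  have hdd : ∀ x ∈ Set.Ioo 0 α, ∀ y ∈ Set.Ioo 0 α, ∀ z ∈ Set.Ioo 0 α,
      divDiff₂ f x y z = x * divDiff₂ g x y z + divDiff₁ g y z := fun x hx y hy z hz ↦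
    divDiff₂_id_mul (hev x hx) (hev y hy) (hev z hz) (hgc x hx) (hgc z hz)
  refine ⟨hg, fun t _ ht i j ↦ hdd _ (ht _) _ (ht i) _ (ht j), fun hmono hconv ↦ ?_⟩
  refine MatrixConvexOn.Ico_of_Ioo (matrixConvexOn_of_kraus_nonneg Set.ordConnected_Ioo hfc ?_)
    hf.continuousOn
  intro x hx k y
  have e : (Matrix.of fun i j ↦ (divDiff₂ f (x i) (x k) (x j) : ℂ)) =
      x k • (Matrix.of fun i j ↦ (divDiff₂ g (x i) (x k) (x j) : ℂ)) +
        Matrix.of fun i j ↦ (divDiff₁ g (x i) (x j) : ℂ) := by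
    ext i j
    simp only [Matrix.of_apply, Matrix.add_apply, Matrix.smul_apply, Complex.real_smul]
    rw [divDiff₂_swap f, divDiff₂_swap g, hdd _ (hx k) _ (hx i) _ (hx j)]
    push_cast
    ring
  rw [e, map_add, map_smul, smul_eq_mul]
  exact add_nonneg (mul_nonneg (hx k).1.le (hconv.kraus_nonneg isOpen_Ioo hgc hx k y))
    (hmono.loewner_nonneg isOpen_Ioo hgc hx y)
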